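/- Let $m\ge 2$ be an integer, $I=[0,1]$ with its Borel $\sigma$-algebra $\mathcal B_I$, and for $i\in\{0,1,2,\dots\}$, $x\in I$, put $$u_i(x)=\frac{m^{-i}}{1+(m-1)x},\qquad P_i(s)=\frac{(m-1)m^{-(i+1)}(s+1)(s+m)}{(s+(m-1)m^{-i}+1)(s+(m-1)m^{-(i+1)}+1)}.$$ Let $Q_m(x,A)=\sum_{i:\,u_i(x)\in A}P_i((m-1)x)$ ($x\in I$, $A\in\mathcal B_I$) be the transition probability of the Markov chain on $I$ that moves from $x$ to $u_i(x)$ with probability $P_i((m-1)x)$, let $Q_m^n$ be its $n$-step transition probability and $U_m^nf(x)=\int_I f(y)\,Q_m^n(x,dy)$. Let $T_m:I\to I$ be given by $T_m(0)=0$ and $T_m(x)=\frac{m^{t-\lfloor t\rfloor}-1}{m-1}$ with $t=\frac{\log x^{-1}}{\log m}$ for $x\ne0$. For $f:I\to\mathbb R$ put $\|f\|_L=\sup_{x}|f(x)|+\sup_{x\ne y}\frac{|f(x)-f(y)|}{|x-y|}$. Let $Q_m^\infty$ be the measure on $I$ with density $c_m\rho_m$ with respect to Lebesgue measure, where $$\rho_m(x)=\frac{1}{(1+(m-1)x)(m+(m-1)x)},\qquad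 c_m=\frac{(m-1)^2}{\log\left(m^2/(2m-1)\right)}.$$ Then $Q_m^\infty$ is a probability measure invariant under $T_m$. It is the unique stationary probability measure of the chain, i.e. the unique probability measure $\mu$ on $\mathcal B_I$ with $\int_I Q_m(x,A)\,\mu(dx)=\mu(A)$ for all $A\in\mathcal B_I$. It is the limiting probability of the chain, i.e. the unique probability measure $\mu$ such that, for every continuous $f:I\to\mathbb R$, $U_m^nf(x)\to\int_I f\,d\mu$ as $n\to\infty$ uniformly in $x\in I$. Moreover there are constants $0<q<1$ and $k>0$, depending only on $m$, such that $\left\|U_m^nf-\int_I f\,dQ_m^\infty\right\|_L\le k\,q^n\,\|f\|_L$ for all $n\ge1$ and all Lipschitz $f:I\to\mathbb R$. -/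

import Mathlib

open Set Filter Topology MeasureTheory ProbabilityTheory
open scoped ENNReal NNReal unitInterval

noncomputable section

namespace ChanCF

/-- The function `P_i` of the continued fraction expansion with parameter `m`:
`P_i(x) = (m-1) m^{-(i+1)} (x+1)(x+m) / ((x+(m-1)m^{-i}+1)(x+(m-1)m^{-(i+1)}+1))`. -/
def P (m i : ℕ) (x : ℝ) : ℝ :=
  ((m : ℝ) - 1) * ((m : ℝ) ^ (i + 1))⁻¹ * (x + 1) * (x + m) /
    ((x + ((m : ℝ) - 1) * ((m : ℝ) ^ i)⁻¹ + 1) * (x + ((m : ℝ) - 1) * ((m : ℝ) ^ (i + 1))⁻¹ + 1))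

/-- The map `u_i(x) = m^{-i} / (1 + (m-1) x)` of the unit interval `I = [0,1]` into itself. -/
def u (m : ℕ) (hm : 2 ≤ m) (i : ℕ) (x : I) : I :=
  ⟨((m : ℝ) ^ i)⁻¹ / (1 + ((m : ℝ) - 1) * (x : ℝ)), by
    have hm' : (2 : ℝ) ≤ m := by exact_mod_cast hm
    have hx : 0 ≤ ((m : ℝ) - 1) * (x : ℝ) := mul_nonneg (by linarith) x.2.1
    have h1 : (1 : ℝ) ≤ (m : ℝ) ^ i := one_le_pow₀ (by linarith)
    refine ⟨by positivity, ?_⟩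
    rw [div_le_one (by linarith)]
    have := inv_le_one_of_one_le₀ h1
    linarith⟩

lemma measurable_P (m i : ℕ) : Measurable (P m i) := by
  unfold P
  fun_prop

lemma measurable_u (m : ℕ) (hm : 2 ≤ m) (i : ℕ) : Measurable (u m hm i) := by
  unfold u
  refine Measurable.subtype_mk ?_
  fun_prop

/-- The transition probability function `Q_m(x, ·)` of the Markov chain on `I`: from the state `x`
the chain jumps to `u_i(x)` with probability `P_i((m-1)x)`, `i = 0, 1, 2, …`. -/
def Q (m : ℕ) (hm : 2 ≤ m) : Kernel I I where
  toFun x := Measure.sum fun i : ℕ =>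
    ENNReal.ofReal (P m i (((m : ℝ) - 1) * (x : ℝ))) • Measure.dirac (u m hm i x)
  measurable' := by
    refine Measure.measurable_of_measurable_coe _ fun s hs => ?_
    simp only [Measure.sum_apply _ hs, Measure.smul_apply, smul_eq_mul]
    refine Measurable.tsum fun i => ?_
    refine Measurable.mul ?_ ?_
    · exact ((measurable_P m i).comp (by fun_prop)).ennreal_ofReal
    · exact (Measure.measurable_coe hs).comp (Measure.measurable_dirac.comp (measurable_u m hm i))

/-- `Q_m(x, A)` is the sum of `P_i((m-1)x)` over those `i` for which `u_i(x) ∈ A`. -/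
lemma Q_apply (m : ℕ) (hm : 2 ≤ m) (x : I) {A : Set I} (hA : MeasurableSet A) :
    Q m hm x A =
      ∑' i : {i : ℕ // u m hm i x ∈ A}, ENNReal.ofReal (P m i (((m : ℝ) - 1) * (x : ℝ))) := by
  rw [show Q m hm x = Measure.sum fun i : ℕ =>
    ENNReal.ofReal (P m i (((m : ℝ) - 1) * (x : ℝ))) • Measure.dirac (u m hm i x) from rfl,
    Measure.sum_apply _ hA]
  refine Eq.trans (tsum_congr fun i => ?_) (tsum_subtype {i : ℕ | u m hm i x ∈ A}
    (fun i : ℕ => ENNReal.ofReal (P m i (((m : ℝ) - 1) * (x : ℝ))))).symm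
  by_cases h : u m hm i x ∈ A <;> simp [Measure.dirac_apply' _ hA, h]

/-- The `n`-step transition probability function `Q_m^n`. -/
def Qn (m : ℕ) (hm : 2 ≤ m) : ℕ → Kernel I I
  | 0 => Kernel.id
  | n + 1 => Q m hm ∘ₖ Qn m hm n

/-- The `n`-th power of the Markov operator: `U_m^n f (x) = ∫ f(y) Q_m^n(x, dy)`. -/
def Un (m : ℕ) (hm : 2 ≤ m) (n : ℕ) (f : I → ℝ) (x : I) : ℝ :=
  ∫ y, f y ∂(Qn m hm n x)

/-- The shift transformation: `T_m(0) = 0` and, for `x ≠ 0`,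
`T_m(x) = (m^{t - ⌊t⌋} - 1)/(m - 1)` where `t = log x⁻¹ / log m`. -/
def T (m : ℕ) (hm : 2 ≤ m) (x : I) : I :=
  ⟨if (x : ℝ) = 0 then 0 else
      ((m : ℝ) ^ (Real.log (x : ℝ)⁻¹ / Real.log m - ⌊Real.log (x : ℝ)⁻¹ / Real.log m⌋) - 1) /
        ((m : ℝ) - 1), by
    have hm' : (2 : ℝ) ≤ m := by exact_mod_cast hm
    split_ifs
    · simp
    · set t := Real.log (x : ℝ)⁻¹ / Real.log m
      have h0 : 0 ≤ t - ⌊t⌋ := Int.fract_nonneg t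
      have h1 : t - ⌊t⌋ ≤ 1 := (Int.fract_lt_one t).le
      have h2 : (1 : ℝ) ≤ (m : ℝ) ^ (t - ⌊t⌋) := Real.one_le_rpow (by linarith) h0
      have h3 : (m : ℝ) ^ (t - ⌊t⌋) ≤ m := by
        simpa using Real.rpow_le_rpow_of_exponent_le (by linarith : (1 : ℝ) ≤ m) h1
      refine ⟨div_nonneg (by linarith) (by linarith), ?_⟩
      rw [div_le_one (by linarith)]
      linarith⟩

/-- `ρ_m(x) = 1 / ((1+(m-1)x)(m+(m-1)x))`. -/
def ρ (m : ℕ) (x : ℝ) : ℝ :=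
  1 / ((1 + ((m : ℝ) - 1) * x) * ((m : ℝ) + ((m : ℝ) - 1) * x))

/-- The normalizing factor `c_m = (m-1)² / log (m² / (2m-1))`. -/
def c (m : ℕ) : ℝ :=
  ((m : ℝ) - 1) ^ 2 / Real.log ((m : ℝ) ^ 2 / (2 * (m : ℝ) - 1))

/-- The measure on `I` with density `c_m ρ_m` with respect to Lebesgue measure. -/
def γ (m : ℕ) : Measure I :=
  (volume : Measure I).withDensity fun x => ENNReal.ofReal (c m * ρ m (x : ℝ))

/-- `μ` is stationary for the chain: `∫ Q_m(x, A) μ(dx) = μ(A)` for all Borel sets `A`. -/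
def IsStationary (m : ℕ) (hm : 2 ≤ m) (μ : Measure I) : Prop :=
  ∀ A : Set I, MeasurableSet A → ∫⁻ x, Q m hm x A ∂μ = μ A

/-- `μ` is the limit of the `n`-step transition probabilities: `Q_m^n(x, ·)` converges weakly
to `μ`, uniformly in the initial state `x`. -/
def IsLimit (m : ℕ) (hm : 2 ≤ m) (μ : Measure I) : Prop :=
  ∀ f : I → ℝ, Continuous f →
    TendstoUniformly (fun n x => Un m hm n f x) (fun _ => ∫ y, f y ∂μ) atTop

/-- The norm `‖f‖_L = sup |f| + sup_{x ≠ y} |f(x) - f(y)| / |x - y|`, with values in `[0, ∞]`;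
it is finite exactly on the Lipschitz functions. -/
def normL (f : I → ℝ) : ℝ≥0∞ :=
  (⨆ x : I, ENNReal.ofReal |f x|) +
    ⨆ (x : I) (y : I) (_ : x ≠ y), ENNReal.ofReal (|f x - f y| / |(x : ℝ) - (y : ℝ)|)

end ChanCF

end

noncomputable section

namespace ChanCF

/-! The one-step operator contracts a Lipschitz seminorm for a truncated metric. In the Euclidean
metric `u_0` need not contract (its slope at 0 is `-(m-1)`), but in `gauge` every branch contracts
by `(m-1)/m` (`gauge_u_le`). The weights also vary with the state; measuring oscillation against
`min 1 (gauge/δ)` turns that error into a term of order `δ`, so nearby points contract once `δ` is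
small (`step_sub_le_gauge`). For distant points, branch 0 has probability at least 1/3 everywhere,
so following it from both points brings a fixed share of the mass close together
(`iterate_step_sub_le_osc`). Hence some iterate is a strict contraction, and oscillations decay
geometrically (`exists_geometric_bound`).

The measure `γ` is stationary by a change of variables on each branch (`lintegral_lintegral_Q_γ`):
the chain is the shift `T` run backwards. Invariance under `T` follows from `T ∘ u_i = id` off the
endpoint 1. As `exists_rate` holds for every stationary probability measure, uniqueness follows too,
with polynomials passing from Lipschitz to continuous functions. -/

/-! ### Transition weights -/

lemma P_nonneg {m : ℕ} (hm : 2 ≤ m) (i : ℕ) {s : ℝ} (hs : 0 ≤ s) : 0 ≤ P m i s := by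
  have hm' : (2 : ℝ) ≤ m := by exact_mod_cast hm
  have ha : (0 : ℝ) ≤ (m : ℝ) - 1 := by linarith
  unfold P
  positivity

/-- The weights `P m i s` telescope. -/
lemma P_eq_sub {m : ℕ} (hm : 2 ≤ m) (i : ℕ) {s : ℝ} (hs : 0 ≤ s) :
    P m i s = (s + 1) * (s + m) / ((m : ℝ) - 1) *
      ((s + 1 + ((m : ℝ) - 1) * ((m : ℝ) ^ (i + 1))⁻¹)⁻¹ -
        (s + 1 + ((m : ℝ) - 1) * ((m : ℝ) ^ i)⁻¹)⁻¹) := by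
  have hm' : (2 : ℝ) ≤ m := by exact_mod_cast hm
  have ha : (0 : ℝ) < (m : ℝ) - 1 := by linarith
  have hm0 : (0 : ℝ) < m := by linarith
  have hb : 0 < ((m : ℝ) ^ (i + 1))⁻¹ := by positivity
  have hbi : ((m : ℝ) ^ i)⁻¹ = m * ((m : ℝ) ^ (i + 1))⁻¹ := by
    rw [pow_succ]; field_simp
  unfold P
  rw [hbi]
  generalize ((m : ℝ) ^ (i + 1))⁻¹ = b at *
  have h1 : 0 < s + ((m : ℝ) - 1) * (m * b) + 1 := by positivity
  have h2 : 0 < s + ((m : ℝ) - 1) * b + 1 := by positivity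
  have h3 : 0 < s + 1 + ((m : ℝ) - 1) * (m * b) := by positivity
  have h4 : 0 < s + 1 + ((m : ℝ) - 1) * b := by positivity
  field_simp
  ring

lemma tendsto_inv_pow {m : ℕ} (hm : 2 ≤ m) :
    Tendsto (fun i : ℕ => ((m : ℝ) ^ i)⁻¹) atTop (𝓝 0) := by
  have hm' : (2 : ℝ) ≤ m := by exact_mod_cast hm
  exact tendsto_inv_atTop_zero.comp (tendsto_pow_atTop_atTop_of_one_lt (by linarith))

/-- The telescoping sum runs from `(s+m)⁻¹` at `i = 0` to the limit `(s+1)⁻¹`, and the prefactor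
normalizes the difference. -/
lemma hasSum_P {m : ℕ} (hm : 2 ≤ m) {s : ℝ} (hs : 0 ≤ s) :
    HasSum (fun i => P m i s) 1 := by
  have hm' : (2 : ℝ) ≤ m := by exact_mod_cast hm
  have ha : (0 : ℝ) < (m : ℝ) - 1 := by linarith
  rw [hasSum_iff_tendsto_nat_of_nonneg (fun i => P_nonneg hm i hs)]
  have hsum : ∀ n : ℕ, ∑ i ∈ Finset.range n, P m i s =
      (s + 1) * (s + m) / ((m : ℝ) - 1) *
        ((s + 1 + ((m : ℝ) - 1) * ((m : ℝ) ^ n)⁻¹)⁻¹ - (s + m)⁻¹) := by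
    intro n
    rw [Finset.sum_congr rfl fun i _ => P_eq_sub hm i hs, ← Finset.mul_sum,
      Finset.sum_range_sub (fun i => (s + 1 + ((m : ℝ) - 1) * ((m : ℝ) ^ i)⁻¹)⁻¹)]
    congr 3
    simp
  simp_rw [hsum]
  have hlim : Tendsto (fun n : ℕ => (s + 1) * (s + m) / ((m : ℝ) - 1) *
        ((s + 1 + ((m : ℝ) - 1) * ((m : ℝ) ^ n)⁻¹)⁻¹ - (s + m)⁻¹)) atTop
      (𝓝 ((s + 1) * (s + m) / ((m : ℝ) - 1) *
        ((s + 1 + ((m : ℝ) - 1) * 0)⁻¹ - (s + m)⁻¹))) := by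
    refine Tendsto.const_mul _ (Tendsto.sub_const (Tendsto.inv₀ ?_ (by positivity)) _)
    exact ((tendsto_inv_pow hm).const_mul _).const_add _
  convert hlim using 2
  have : (0 : ℝ) < s + m := by linarith
  field_simp
  ring

/-- The minorization behind the coupling of distant points; 1/3 is attained at `m = 2`, `s = 0`. -/
lemma P_zero_lower {m : ℕ} (hm : 2 ≤ m) {s : ℝ} (hs : 0 ≤ s) : 1 / 3 ≤ P m 0 s := by
  have hm' : (2 : ℝ) ≤ m := by exact_mod_cast hm
  have ha : (0 : ℝ) < (m : ℝ) - 1 := by linarith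
  have h : P m 0 s = ((m : ℝ) - 1) * (s + 1) / (m * (s + 1) + (m - 1)) := by
    unfold P
    have h1 : 0 < s + ((m : ℝ) - 1) + 1 := by linarith
    have h2 : 0 < s + ((m : ℝ) - 1) * (m : ℝ)⁻¹ + 1 := by positivity
    have h3 : 0 < (m : ℝ) * (s + 1) + (m - 1) := by positivity
    simp only [zero_add, pow_one, pow_zero, inv_one, mul_one]
    field_simp
    ring
  rw [h, div_le_div_iff₀ (by norm_num) (by positivity)]
  nlinarith [mul_nonneg ha.le hs]

/-- The weights are Lipschitz in `s`, with summable constants. -/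
lemma abs_P_sub_le {m : ℕ} (hm : 2 ≤ m) (i : ℕ) {s t : ℝ} (hs : 0 ≤ s) (ht : 0 ≤ t) :
    |P m i s - P m i t| ≤ 2 * (m : ℝ) ^ 3 * ((m : ℝ) ^ (i + 1))⁻¹ * |s - t| := by
  have hm' : (2 : ℝ) ≤ m := by exact_mod_cast hm
  have ha : (0 : ℝ) < (m : ℝ) - 1 := by linarith
  have hb : 0 < ((m : ℝ) ^ (i + 1))⁻¹ := by positivity
  have hb1 : ((m : ℝ) ^ (i + 1))⁻¹ ≤ 1 := inv_le_one_of_one_le₀ (one_le_pow₀ (by linarith))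
  have hc : 0 < ((m : ℝ) ^ i)⁻¹ := by positivity
  have hc1 : ((m : ℝ) ^ i)⁻¹ ≤ 1 := inv_le_one_of_one_le₀ (one_le_pow₀ (by linarith))
  unfold P
  generalize ((m : ℝ) ^ (i + 1))⁻¹ = b at *
  generalize ((m : ℝ) ^ i)⁻¹ = e at *
  set β := ((m : ℝ) - 1) * b with hβ
  set ε := ((m : ℝ) - 1) * e with hε
  have hβ0 : 0 < β := by positivity
  have hε0 : 0 < ε := by positivity
  have hβm : β ≤ m := by nlinarith
  have hεm : ε ≤ m := by nlinarith
  -- The weight is `β` times a factor bounded by 1 and a factor bounded by `m`, each `m`-Lipschitz;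
  -- `β` supplies the summable decay in `i`.
  have hF : ∀ r : ℝ, 0 ≤ r → |(r + 1) / (r + β + 1)| ≤ 1 := fun r hr => by
    rw [abs_of_nonneg (by positivity), div_le_one (by positivity)]; linarith
  have hG : ∀ r : ℝ, 0 ≤ r → |(r + m) / (r + ε + 1)| ≤ m := fun r hr => by
    rw [abs_of_nonneg (by positivity), div_le_iff₀ (by positivity)]
    nlinarith [mul_nonneg hr ha.le]
  have hFd : |(s + 1) / (s + β + 1) - (t + 1) / (t + β + 1)| ≤ m * |s - t| := by
    have : (s + 1) / (s + β + 1) - (t + 1) / (t + β + 1) =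
        β / ((s + β + 1) * (t + β + 1)) * (s - t) := by
      have h1 : 0 < s + β + 1 := by positivity
      have h2 : 0 < t + β + 1 := by positivity
      field_simp; ring
    rw [this, abs_mul]
    gcongr
    rw [abs_of_nonneg (by positivity), div_le_iff₀ (by positivity)]
    have : 1 ≤ (s + β + 1) * (t + β + 1) := by
      nlinarith [mul_nonneg (add_nonneg hs hβ0.le) (add_nonneg ht hβ0.le)]
    nlinarith
  have hGd : |(s + m) / (s + ε + 1) - (t + m) / (t + ε + 1)| ≤ m * |s - t| := by
    have : (s + m) / (s + ε + 1) - (t + m) / (t + ε + 1) =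
        (ε + 1 - m) / ((s + ε + 1) * (t + ε + 1)) * (s - t) := by
      have h1 : 0 < s + ε + 1 := by positivity
      have h2 : 0 < t + ε + 1 := by positivity
      field_simp; ring
    rw [this, abs_mul]
    gcongr
    rw [abs_div, abs_of_pos (by positivity : 0 < (s + ε + 1) * (t + ε + 1)),
      div_le_iff₀ (by positivity)]
    have : 1 ≤ (s + ε + 1) * (t + ε + 1) := by
      nlinarith [mul_nonneg (add_nonneg hs hε0.le) (add_nonneg ht hε0.le)]
    have : |ε + 1 - m| ≤ m := abs_le.2 ⟨by linarith, by nlinarith⟩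
    nlinarith
  have hsplit : ∀ r : ℝ, 0 ≤ r → β * (r + 1) * (r + m) / ((r + ε + 1) * (r + β + 1)) =
      β * ((r + 1) / (r + β + 1) * ((r + m) / (r + ε + 1))) := fun r hr => by
    have h1 : 0 < r + β + 1 := by positivity
    have h2 : 0 < r + ε + 1 := by positivity
    field_simp
  rw [hsplit s hs, hsplit t ht, ← mul_sub, abs_mul, abs_of_pos hβ0]
  have hprod : |(s + 1) / (s + β + 1) * ((s + m) / (s + ε + 1)) -
      (t + 1) / (t + β + 1) * ((t + m) / (t + ε + 1))| ≤ 2 * m ^ 2 * |s - t| := by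
    have hd := abs_nonneg (s - t)
    calc _ = |(s + 1) / (s + β + 1) * ((s + m) / (s + ε + 1) - (t + m) / (t + ε + 1)) +
          ((s + 1) / (s + β + 1) - (t + 1) / (t + β + 1)) * ((t + m) / (t + ε + 1))| := by
          congr 1; ring
      _ ≤ 1 * (m * |s - t|) + (m * |s - t|) * m := by
          refine (abs_add_le _ _).trans ?_
          rw [abs_mul, abs_mul]
          gcongr
          · exact hF s hs
          · exact hG t ht
      _ ≤ 2 * m ^ 2 * |s - t| := by nlinarith [mul_nonneg hd (by linarith : (0 : ℝ) ≤ m - 1)]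
  calc _ ≤ β * (2 * m ^ 2 * |s - t|) := by gcongr
    _ ≤ (m * b) * (2 * m ^ 2 * |s - t|) := by
        gcongr
        nlinarith
    _ = _ := by ring

lemma hasSum_inv_pow_succ {m : ℕ} (hm : 2 ≤ m) :
    HasSum (fun i : ℕ => ((m : ℝ) ^ (i + 1))⁻¹) ((m : ℝ) - 1)⁻¹ := by
  have hm' : (2 : ℝ) ≤ m := by exact_mod_cast hm
  have ha : (0 : ℝ) < (m : ℝ) - 1 := by linarith
  have h := (hasSum_geometric_of_lt_one (r := (m : ℝ)⁻¹) (by positivity)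
    (inv_lt_one_of_one_lt₀ (by linarith))).mul_left (m : ℝ)⁻¹
  have e1 : (fun i : ℕ => ((m : ℝ) ^ (i + 1))⁻¹) = fun i : ℕ => (m : ℝ)⁻¹ * (m : ℝ)⁻¹ ^ i := by
    ext i; rw [pow_succ, mul_inv, inv_pow, mul_comm]
  have e2 : ((m : ℝ) - 1)⁻¹ = (m : ℝ)⁻¹ * (1 - (m : ℝ)⁻¹)⁻¹ := by
    rw [← mul_inv, mul_sub, mul_one, mul_inv_cancel₀ (by linarith)]
  rw [e1, e2]
  exact h

/-! ### The gauge and its contraction by the branches -/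

/-- The rescaled state `s = (m - 1) x`. -/
def scale (m : ℕ) (x : I) : ℝ := ((m : ℝ) - 1) * (x : ℝ)

lemma scale_nonneg {m : ℕ} (hm : 2 ≤ m) (x : I) : 0 ≤ scale m x := by
  have hm' : (2 : ℝ) ≤ m := by exact_mod_cast hm
  exact mul_nonneg (by linarith) x.2.1

lemma scale_le {m : ℕ} (hm : 2 ≤ m) (x : I) : scale m x ≤ (m : ℝ) - 1 := by
  have hm' : (2 : ℝ) ≤ m := by exact_mod_cast hm
  exact mul_le_of_le_one_right (by linarith) x.2.2

lemma abs_scale_sub {m : ℕ} (hm : 2 ≤ m) (x y : I) :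
    |scale m x - scale m y| = ((m : ℝ) - 1) * |(x : ℝ) - y| := by
  have hm' : (2 : ℝ) ≤ m := by exact_mod_cast hm
  rw [scale, scale, ← mul_sub, abs_mul, abs_of_nonneg (by linarith)]

/-- A gauge on `I`, comparable with the Euclidean distance, which all the maps `u m hm i`
contract by the same factor `(m - 1) / m`. -/
def gauge (m : ℕ) (x y : I) : ℝ :=
  |scale m x - scale m y| / (√(1 + scale m x) * √(1 + scale m y))

lemma gauge_nonneg (m : ℕ) (x y : I) : 0 ≤ gauge m x y := by
  unfold gauge; positivity

lemma gauge_le_abs {m : ℕ} (hm : 2 ≤ m) (x y : I) :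
    gauge m x y ≤ |scale m x - scale m y| := by
  have hx := scale_nonneg hm x
  have hy := scale_nonneg hm y
  refine div_le_self (abs_nonneg _) ?_
  exact one_le_mul_of_one_le_of_one_le (Real.one_le_sqrt.2 (by linarith))
    (Real.one_le_sqrt.2 (by linarith))

lemma abs_le_gauge {m : ℕ} (hm : 2 ≤ m) (x y : I) :
    |scale m x - scale m y| ≤ m * gauge m x y := by
  have hm' : (2 : ℝ) ≤ m := by exact_mod_cast hm
  have hx := scale_nonneg hm x
  have hy := scale_nonneg hm y
  have h : √(1 + scale m x) * √(1 + scale m y) ≤ m := by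
    calc _ ≤ √m * √m := by
          gcongr
          · linarith [scale_le hm x]
          · linarith [scale_le hm y]
      _ = m := Real.mul_self_sqrt (by linarith)
  have hp : 0 < √(1 + scale m x) * √(1 + scale m y) := by positivity
  rw [gauge, mul_div_assoc', le_div_iff₀ hp, mul_comm]
  gcongr

/-- With `b = (m-1) m⁻ⁱ`, the gauge is multiplied by exactly `b / (√(1+s+b) √(1+t+b))`. This is at
most `b/(1+b)`, and `b ≤ m-1`. -/
lemma gauge_u_le {m : ℕ} (hm : 2 ≤ m) (i : ℕ) (x y : I) :
    gauge m (u m hm i x) (u m hm i y) ≤ ((m : ℝ) - 1) / m * gauge m x y := by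
  have hm' : (2 : ℝ) ≤ m := by exact_mod_cast hm
  have ha : (0 : ℝ) < (m : ℝ) - 1 := by linarith
  have hc : 0 < ((m : ℝ) ^ i)⁻¹ := by positivity
  have hc1 : ((m : ℝ) ^ i)⁻¹ ≤ 1 := inv_le_one_of_one_le₀ (one_le_pow₀ (by linarith))
  have hu : ∀ z : I, scale m (u m hm i z) = ((m : ℝ) - 1) * ((m : ℝ) ^ i)⁻¹ / (1 + scale m z) :=
    fun z => by simp only [scale, u]; rw [mul_div_assoc]
  have hx := scale_nonneg hm x
  have hy := scale_nonneg hm y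
  unfold gauge
  rw [hu, hu]
  generalize scale m x = s at *
  generalize scale m y = t at *
  have hbm : ((m : ℝ) - 1) * ((m : ℝ) ^ i)⁻¹ ≤ m - 1 := mul_le_of_le_one_right ha.le hc1
  have hb0 : 0 < ((m : ℝ) - 1) * ((m : ℝ) ^ i)⁻¹ := by positivity
  generalize ((m : ℝ) - 1) * ((m : ℝ) ^ i)⁻¹ = b at *
  have e : ∀ r : ℝ, 0 ≤ r → √(1 + b / (1 + r)) = √(1 + r + b) / √(1 + r) := fun r hr => by
    rw [← Real.sqrt_div (by positivity)]; congr 1; field_simp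
  have hd : |b / (1 + s) - b / (1 + t)| = b * |s - t| / ((1 + s) * (1 + t)) := by
    have : b / (1 + s) - b / (1 + t) = b / ((1 + s) * (1 + t)) * (t - s) := by field_simp; ring
    rw [this, abs_mul, abs_of_pos (by positivity), abs_sub_comm t s]; ring
  rw [e s hx, e t hy, hd]
  have q1 : √(1 + s) * √(1 + s) = 1 + s := Real.mul_self_sqrt (by linarith)
  have q2 : √(1 + t) * √(1 + t) = 1 + t := Real.mul_self_sqrt (by linarith)
  have p1 : 0 < √(1 + s) := by positivity
  have p2 : 0 < √(1 + t) := by positivity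
  have p3 : 0 < √(1 + s + b) := by positivity
  have p4 : 0 < √(1 + t + b) := by positivity
  have key : b / (√(1 + s + b) * √(1 + t + b)) ≤ ((m : ℝ) - 1) / m := by
    have h1 : 1 + b ≤ √(1 + s + b) * √(1 + t + b) := by
      calc 1 + b = √(1 + b) * √(1 + b) := (Real.mul_self_sqrt (by linarith)).symm
        _ ≤ _ := by gcongr <;> linarith
    rw [div_le_div_iff₀ (by positivity) (by positivity)]
    calc b * m ≤ (m - 1) * (1 + b) := by nlinarith
      _ ≤ _ := by gcongr
  calc b * |s - t| / ((1 + s) * (1 + t)) / (√(1 + s + b) / √(1 + s) * (√(1 + t + b) / √(1 + t)))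
      = b / (√(1 + s + b) * √(1 + t + b)) * (|s - t| / (√(1 + s) * √(1 + t))) := by
        nth_rewrite 1 [← q1]
        nth_rewrite 1 [← q2]
        generalize √(1 + s) = v at *
        generalize √(1 + t) = w at *
        field_simp
    _ ≤ _ := by gcongr

/-! ### The Markov operator and its contraction -/

lemma Q_eq_sum (m : ℕ) (hm : 2 ≤ m) (x : I) :
    Q m hm x = Measure.sum fun i : ℕ =>
      ENNReal.ofReal (P m i (scale m x)) • Measure.dirac (u m hm i x) := rfl

instance isMarkovKernel_Q (m : ℕ) (hm : 2 ≤ m) : IsMarkovKernel (Q m hm) := by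
  refine ⟨fun x => ⟨?_⟩⟩
  have hs := scale_nonneg hm x
  rw [Q_eq_sum, Measure.sum_apply _ MeasurableSet.univ]
  simp only [Measure.smul_apply, measure_univ, smul_eq_mul, mul_one]
  rw [← ENNReal.ofReal_tsum_of_nonneg (fun i => P_nonneg hm i hs) (hasSum_P hm hs).summable,
    (hasSum_P hm hs).tsum_eq, ENNReal.ofReal_one]

instance isMarkovKernel_Qn (m : ℕ) (hm : 2 ≤ m) (n : ℕ) : IsMarkovKernel (Qn m hm n) := by
  induction n with
  | zero => unfold Qn; infer_instance
  | succ n ih => unfold Qn; infer_instance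

lemma integrable_of_continuous {μ : Measure I} [IsFiniteMeasure μ] {f : I → ℝ}
    (hf : Continuous f) : Integrable f μ :=
  hf.integrable_of_hasCompactSupport (HasCompactSupport.of_compactSpace f)

/-- The one-step Markov operator. -/
def step (m : ℕ) (hm : 2 ≤ m) (f : I → ℝ) (x : I) : ℝ := ∫ y, f y ∂(Q m hm x)

lemma hasSum_step (m : ℕ) (hm : 2 ≤ m) {f : I → ℝ} (hf : Continuous f) (x : I) :
    HasSum (fun i => P m i (scale m x) * f (u m hm i x)) (step m hm f x) := by
  have h : Integrable f (Q m hm x) := integrable_of_continuous hf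
  rw [Q_eq_sum] at h
  have h2 := hasSum_integral_measure h
  rw [← Q_eq_sum] at h2
  have e : (fun i => P m i (scale m x) * f (u m hm i x)) = fun i => ∫ y, f y
      ∂(ENNReal.ofReal (P m i (scale m x)) • Measure.dirac (u m hm i x)) := by
    ext i
    rw [integral_smul_measure, integral_dirac,
      ENNReal.toReal_ofReal (P_nonneg hm i (scale_nonneg hm x)), smul_eq_mul]
  rw [e]
  exact h2

/-- `f` oscillates by at most `L * min 1 (gauge / δ)`. -/
def OscBound (m : ℕ) (δ L : ℝ) (f : I → ℝ) : Prop :=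
  ∀ x y : I, |f x - f y| ≤ L ∧ |f x - f y| ≤ L * (gauge m x y / δ)

lemma OscBound.nonneg {m : ℕ} {δ L : ℝ} {f : I → ℝ} (h : OscBound m δ L f) : 0 ≤ L :=
  (abs_nonneg _).trans (h 0 0).1

lemma OscBound.abs_sub_le {m : ℕ} (hm : 2 ≤ m) {δ L : ℝ} (hδ : 0 < δ) {f : I → ℝ}
    (h : OscBound m δ L f) (x y : I) :
    |f x - f y| ≤ L * ((m : ℝ) - 1) / δ * |(x : ℝ) - y| := by
  have hL := h.nonneg
  calc |f x - f y| ≤ L * (gauge m x y / δ) := (h x y).2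
    _ ≤ L * (|scale m x - scale m y| / δ) := by gcongr; exact gauge_le_abs hm x y
    _ = _ := by rw [abs_scale_sub hm]; ring

lemma OscBound.continuous {m : ℕ} (hm : 2 ≤ m) {δ L : ℝ} (hδ : 0 < δ) {f : I → ℝ}
    (h : OscBound m δ L f) : Continuous f := by
  have hm' : (2 : ℝ) ≤ m := by exact_mod_cast hm
  have hL := h.nonneg
  have hC : 0 ≤ L * ((m : ℝ) - 1) / δ := div_nonneg (mul_nonneg hL (by linarith)) hδ.le
  refine (LipschitzWith.of_dist_le_mul (K := ⟨_, hC⟩) fun x y => ?_).continuous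
  rw [Real.dist_eq, Subtype.dist_eq, Real.dist_eq]
  exact h.abs_sub_le hm hδ x y

/-- Moving the branch points costs the gauge factor `(m-1)/m`. Changing the weights costs a multiple
of `gauge * L`, which is `δ` times the unit `L * (gauge/δ)`. -/
lemma step_sub_le_gauge {m : ℕ} (hm : 2 ≤ m) {δ L : ℝ} (hδ : 0 < δ) {f : I → ℝ}
    (h : OscBound m δ L f) (x y : I) :
    |step m hm f x - step m hm f y| ≤
      (((m : ℝ) - 1) / m + δ * (2 * (m : ℝ) ^ 4 * ((m : ℝ) - 1)⁻¹)) * L * (gauge m x y / δ) := by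
  have hm' : (2 : ℝ) ≤ m := by exact_mod_cast hm
  have hL := h.nonneg
  have hf := h.continuous hm hδ
  have hx := scale_nonneg hm x
  have hy := scale_nonneg hm y
  have hd := gauge_nonneg m x y
  set d := gauge m x y with hd_def
  -- Both weight families have sum 1, so subtracting the constant `f x` is free; it makes the weight
  -- error involve only the oscillation of `f`, not its size.
  have h1 : HasSum (fun i => P m i (scale m x) * f (u m hm i x)
      - P m i (scale m y) * f (u m hm i y)
      - (P m i (scale m x) - P m i (scale m y)) * f x)
      (step m hm f x - step m hm f y - (1 - 1) * f x) :=
    ((hasSum_step m hm hf x).sub (hasSum_step m hm hf y)).sub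
      (((hasSum_P hm hx).sub (hasSum_P hm hy)).mul_right _)
  have h2 : HasSum (fun i => P m i (scale m x) * (((m : ℝ) - 1) / m * L * (d / δ)) +
      ((m : ℝ) ^ (i + 1))⁻¹ * (2 * (m : ℝ) ^ 4 * d * L))
      (1 * (((m : ℝ) - 1) / m * L * (d / δ)) + ((m : ℝ) - 1)⁻¹ * (2 * (m : ℝ) ^ 4 * d * L)) :=
    ((hasSum_P hm hx).mul_right _).add ((hasSum_inv_pow_succ hm).mul_right _)
  have h3 := h1.norm_le_of_bounded h2 fun i => by
    have e : P m i (scale m x) * f (u m hm i x) - P m i (scale m y) * f (u m hm i y)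
        - (P m i (scale m x) - P m i (scale m y)) * f x =
        P m i (scale m x) * (f (u m hm i x) - f (u m hm i y)) +
        (P m i (scale m x) - P m i (scale m y)) * (f (u m hm i y) - f x) := by ring
    rw [e, Real.norm_eq_abs]
    refine (abs_add_le _ _).trans ?_
    rw [abs_mul, abs_mul, abs_of_nonneg (P_nonneg hm i hx)]
    have b1 : |f (u m hm i x) - f (u m hm i y)| ≤ ((m : ℝ) - 1) / m * L * (d / δ) := by
      calc _ ≤ L * (gauge m (u m hm i x) (u m hm i y) / δ) := (h _ _).2
        _ ≤ L * (((m : ℝ) - 1) / m * d / δ) := by gcongr; exact gauge_u_le hm i x y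
        _ = _ := by ring
    have b2 : |P m i (scale m x) - P m i (scale m y)| ≤
        2 * (m : ℝ) ^ 3 * ((m : ℝ) ^ (i + 1))⁻¹ * (m * d) :=
      (abs_P_sub_le hm i hx hy).trans (by gcongr; exact abs_le_gauge hm x y)
    have b3 : |f (u m hm i y) - f x| ≤ L := (h _ _).1
    calc _ ≤ P m i (scale m x) * (((m : ℝ) - 1) / m * L * (d / δ)) +
          2 * (m : ℝ) ^ 3 * ((m : ℝ) ^ (i + 1))⁻¹ * (m * d) * L := by
          gcongr
          exact P_nonneg hm i hx
      _ = _ := by ring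
  rw [sub_self, zero_mul, sub_zero, Real.norm_eq_abs] at h3
  refine h3.trans (le_of_eq ?_)
  field_simp

/-- Mass 1/3 is coupled along branch 0 from both points; the remaining 2/3 contributes at most its
share of the total oscillation. -/
lemma step_sub_le_osc {m : ℕ} (hm : 2 ≤ m) {B : ℝ} {f : I → ℝ} (hf : Continuous f)
    (hB : ∀ x y, |f x - f y| ≤ B) (x y : I) :
    |step m hm f x - step m hm f y| ≤
      2 / 3 * B + 1 / 3 * |f (u m hm 0 x) - f (u m hm 0 y)| := by
  -- All values of `f` lie in `[f z, f z + B]`, so keeping only the branch 0 term gives one-sided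
  -- bounds from either end of this interval.
  obtain ⟨z, -, hz⟩ := isCompact_univ.exists_isMinOn univ_nonempty hf.continuousOn
  have hz' : ∀ y, f z ≤ f y := fun y => hz (mem_univ y)
  have hu : ∀ y, f y ≤ f z + B := fun y => by linarith [(abs_le.1 (hB y z)).2]
  have lower : ∀ x, 1 / 3 * (f (u m hm 0 x) - f z) ≤ step m hm f x - f z := fun x => by
    have hx := scale_nonneg hm x
    have h1 : HasSum (fun i => P m i (scale m x) * f (u m hm i x) - P m i (scale m x) * f z)
      (step m hm f x - 1 * f z) := (hasSum_step m hm hf x).sub ((hasSum_P hm hx).mul_right _)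
    have h2 := le_hasSum h1 0 fun i _ => by
      rw [← mul_sub]
      exact mul_nonneg (P_nonneg hm i hx) (sub_nonneg.2 (hz' _))
    rw [← mul_sub, one_mul] at h2
    refine le_trans ?_ h2
    exact mul_le_mul_of_nonneg_right (P_zero_lower hm hx) (sub_nonneg.2 (hz' _))
  have upper : ∀ x, 1 / 3 * (f z + B - f (u m hm 0 x)) ≤ f z + B - step m hm f x := fun x => by
    have hx := scale_nonneg hm x
    have h1 : HasSum (fun i => P m i (scale m x) * (f z + B) - P m i (scale m x) * f (u m hm i x))
      (1 * (f z + B) - step m hm f x) := ((hasSum_P hm hx).mul_right _).sub (hasSum_step m hm hf x)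
    have h2 := le_hasSum h1 0 fun i _ => by
      rw [← mul_sub]
      exact mul_nonneg (P_nonneg hm i hx) (sub_nonneg.2 (hu _))
    rw [← mul_sub, one_mul] at h2
    refine le_trans ?_ h2
    exact mul_le_mul_of_nonneg_right (P_zero_lower hm hx) (sub_nonneg.2 (hu _))
  rw [abs_le]
  have k1 := le_abs_self (f (u m hm 0 x) - f (u m hm 0 y))
  have k2 := neg_abs_le (f (u m hm 0 x) - f (u m hm 0 y))
  constructor <;> linarith [lower x, lower y, upper x, upper y]

lemma step_sub_le {m : ℕ} (hm : 2 ≤ m) {B : ℝ} {f : I → ℝ} (hf : Continuous f)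
    (hB : ∀ x y, |f x - f y| ≤ B) (x y : I) :
    |step m hm f x - step m hm f y| ≤ B := by
  linarith [step_sub_le_osc hm hf hB x y, hB (u m hm 0 x) (u m hm 0 y)]

lemma OscBound.map_step {m : ℕ} (hm : 2 ≤ m) {δ L : ℝ} (hδ : 0 < δ)
    (hδ1 : ((m : ℝ) - 1) / m + δ * (2 * (m : ℝ) ^ 4 * ((m : ℝ) - 1)⁻¹) ≤ 1) {f : I → ℝ}
    (h : OscBound m δ L f) : OscBound m δ L (step m hm f) := fun x y => by
  refine ⟨step_sub_le hm (h.continuous hm hδ) (fun x y => (h x y).1) x y, ?_⟩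
  refine (step_sub_le_gauge hm hδ h x y).trans ?_
  have hL := h.nonneg
  have hg := gauge_nonneg m x y
  rw [mul_assoc]
  exact mul_le_of_le_one_left (by positivity) hδ1

lemma OscBound.map_iterate {m : ℕ} (hm : 2 ≤ m) {δ L : ℝ} (hδ : 0 < δ)
    (hδ1 : ((m : ℝ) - 1) / m + δ * (2 * (m : ℝ) ^ 4 * ((m : ℝ) - 1)⁻¹) ≤ 1) {f : I → ℝ}
    (h : OscBound m δ L f) (n : ℕ) : OscBound m δ L ((step m hm)^[n] f) := by
  induction n with
  | zero => exact h
  | succ n ih => rw [Function.iterate_succ_apply']; exact ih.map_step hm hδ hδ1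

lemma gauge_iterate_u_le {m : ℕ} (hm : 2 ≤ m) (n : ℕ) (x y : I) :
    gauge m ((u m hm 0)^[n] x) ((u m hm 0)^[n] y) ≤ (((m : ℝ) - 1) / m) ^ n * m := by
  have hm' : (2 : ℝ) ≤ m := by exact_mod_cast hm
  have hr : 0 ≤ ((m : ℝ) - 1) / m := div_nonneg (by linarith) (by linarith)
  induction n with
  | zero =>
    simp only [Function.iterate_zero, id, pow_zero, one_mul]
    refine (gauge_le_abs hm x y).trans (abs_le.2 ⟨?_, ?_⟩) <;>
    linarith [scale_nonneg hm x, scale_nonneg hm y, scale_le hm x, scale_le hm y]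
  | succ n ih =>
    rw [Function.iterate_succ_apply', Function.iterate_succ_apply']
    refine (gauge_u_le hm 0 _ _).trans ?_
    rw [pow_succ', mul_assoc]
    gcongr

/-- Following the branch `u m hm 0` for `n` steps. -/
lemma iterate_step_sub_le_osc {m : ℕ} (hm : 2 ≤ m) {B : ℝ} {f : I → ℝ}
    (hc : ∀ n, Continuous ((step m hm)^[n] f)) (hB : ∀ x y, |f x - f y| ≤ B) (n : ℕ) (x y : I) :
    |(step m hm)^[n] f x - (step m hm)^[n] f y| ≤ (1 - (1 / 3) ^ n) * B +
      (1 / 3) ^ n * |f ((u m hm 0)^[n] x) - f ((u m hm 0)^[n] y)| := by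
  have hBn : ∀ n x y, |(step m hm)^[n] f x - (step m hm)^[n] f y| ≤ B := by
    intro n
    induction n with
    | zero => exact hB
    | succ n ih => rw [Function.iterate_succ_apply']; exact step_sub_le hm (hc n) ih
  induction n generalizing x y with
  | zero => simp
  | succ n ih =>
    have h1 := step_sub_le_osc hm (hc n) (hBn n) x y
    have h2 := ih (u m hm 0 x) (u m hm 0 y)
    rw [Function.iterate_succ_apply', Function.iterate_succ_apply, Function.iterate_succ_apply,
      pow_succ]
    linarith

/-- For a suitable `δ`, some iterate of the Markov operator is a strict contraction for the
seminorm attached to `OscBound m δ`. -/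
lemma exists_contraction {m : ℕ} (hm : 2 ≤ m) :
    ∃ δ q : ℝ, ∃ N : ℕ, 0 < δ ∧ δ ≤ ((m : ℝ) - 1) / m ∧
      0 < q ∧ q < 1 ∧ 0 < N ∧ (∀ (L : ℝ) (f : I → ℝ), OscBound m δ L f →
        OscBound m δ L (step m hm f)) ∧
      ∀ (L : ℝ) (f : I → ℝ), OscBound m δ L f →
        OscBound m δ (q * L) ((step m hm)^[N] f) := by
  have hm' : (2 : ℝ) ≤ m := by exact_mod_cast hm
  have ha : (0 : ℝ) < (m : ℝ) - 1 := by linarith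
  set r := ((m : ℝ) - 1) / m with hr
  have hr0 : 0 < r := by positivity
  have hr1 : r < 1 := by rw [hr, div_lt_one (by linarith)]; linarith
  set C := 2 * (m : ℝ) ^ 4 * ((m : ℝ) - 1)⁻¹ with hC
  have hC0 : 0 < C := by positivity
  -- `r + δ * C < 1` gives local contraction; `δ ≤ r` later lets a Euclidean Lipschitz constant
  -- serve directly as `L`.
  obtain ⟨δ, hδ0, hδr, hδC⟩ : ∃ δ, 0 < δ ∧ δ ≤ r ∧ r + δ * C < 1 := by
    refine ⟨min r ((1 - r) / (2 * C)), lt_min hr0 (div_pos (by linarith) (by positivity)),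
      min_le_left _ _, ?_⟩
    have : min r ((1 - r) / (2 * C)) * C ≤ (1 - r) / (2 * C) * C := by
      gcongr; exact min_le_right _ _
    have e : (1 - r) / (2 * C) * C = (1 - r) / 2 := by field_simp
    linarith
  -- After `N + 1` steps along branch 0, any two points have `gauge/δ` at most 1/2, so `f` differs
  -- there by at most `L/2`. The extra step keeps the number of iterations positive.
  obtain ⟨N, hN⟩ := exists_pow_lt_of_lt_one (show 0 < δ / (2 * m) by positivity) hr1
  have hN' : r ^ (N + 1) * m / δ ≤ 1 / 2 := by
    have : r ^ (N + 1) ≤ δ / (2 * m) := by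
      rw [pow_succ]
      exact (mul_le_of_le_one_right (by positivity) hr1.le).trans hN.le
    calc r ^ (N + 1) * m / δ ≤ δ / (2 * m) * m / δ := by gcongr
      _ = 1 / 2 := by field_simp
  have hp : (0 : ℝ) < (1 / 3) ^ (N + 1) := by positivity
  have hp1 : ((1 : ℝ) / 3) ^ (N + 1) ≤ 1 := pow_le_one₀ (by norm_num) (by norm_num)
  refine ⟨δ, max (r + δ * C) (1 - (1 / 3) ^ (N + 1) / 2), N + 1, hδ0, hδr, ?_, ?_, N.succ_pos,
    fun L f h => h.map_step hm hδ0 hδC.le, ?_⟩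
  · exact lt_max_of_lt_left (by positivity)
  · exact max_lt hδC (by linarith)
  intro L f h x y
  have hL := h.nonneg
  have hg := gauge_nonneg m x y
  have hit := fun n => h.map_iterate hm hδ0 hδC.le n
  constructor
  · refine (iterate_step_sub_le_osc hm (fun n => (hit n).continuous hm hδ0)
      (fun x y => (h x y).1) (N + 1) x y).trans ?_
    have b1 : |f ((u m hm 0)^[N + 1] x) - f ((u m hm 0)^[N + 1] y)| ≤ L * (1 / 2) := by
      refine (h _ _).2.trans (mul_le_mul_of_nonneg_left (le_trans ?_ hN') hL)
      gcongr
      exact gauge_iterate_u_le hm (N + 1) x y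
    calc _ ≤ (1 - (1 / 3) ^ (N + 1)) * L + (1 / 3) ^ (N + 1) * (L * (1 / 2)) := by gcongr
      _ = (1 - (1 / 3) ^ (N + 1) / 2) * L := by ring
      _ ≤ _ := by gcongr; exact le_max_right _ _
  -- For the gauge bound, `N` steps do no harm and the last one contracts.
  · rw [Function.iterate_succ_apply']
    refine (step_sub_le_gauge hm hδ0 (hit N) x y).trans ?_
    gcongr
    exact le_max_left _ _

lemma exists_geometric_bound {m : ℕ} (hm : 2 ≤ m) :
    ∃ δ q C : ℝ, 0 < δ ∧ δ ≤ ((m : ℝ) - 1) / m ∧ 0 < q ∧ q < 1 ∧ 0 < C ∧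
      ∀ (n : ℕ) (L : ℝ) (f : I → ℝ), OscBound m δ L f →
        OscBound m δ (C * q ^ n * L) ((step m hm)^[n] f) := by
  obtain ⟨δ, q, N, hδ, hδr, hq0, hq1, hN, hstep, hcontr⟩ := exists_contraction hm
  have hit : ∀ (n : ℕ) (L : ℝ) (f : I → ℝ), OscBound m δ L f →
      OscBound m δ L ((step m hm)^[n] f) := fun n L f h => by
    induction n with
    | zero => exact h
    | succ n ih => rw [Function.iterate_succ_apply']; exact hstep _ _ ih
  have hk : ∀ (k : ℕ) (L : ℝ) (f : I → ℝ), OscBound m δ L f →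
      OscBound m δ (q ^ k * L) ((step m hm)^[N * k] f) := fun k L f h => by
    induction k with
    | zero => simpa using h
    | succ k ih =>
      rw [Nat.mul_succ, Nat.add_comm (N * k), Function.iterate_add_apply, pow_succ', mul_assoc]
      exact hcontr _ _ ih
  have hN0 : (N : ℝ) ≠ 0 := by exact_mod_cast hN.ne'
  set θ := q ^ ((N : ℝ)⁻¹) with hθ
  have hθ0 : 0 < θ := Real.rpow_pos_of_pos hq0 _
  have hθ1 : θ < 1 := Real.rpow_lt_one hq0.le hq1 (by positivity)
  have hθN : θ ^ N = q := by rw [hθ, Real.rpow_inv_natCast_pow hq0.le hN.ne']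
  refine ⟨δ, θ, q⁻¹, hδ, hδr, hθ0, hθ1, by positivity, fun n L f h => ?_⟩
  have h1 := hit (n % N) _ _ (hk (n / N) L f h)
  rw [← Function.iterate_add_apply, Nat.mod_add_div] at h1
  -- As `θ ^ N = q` and `n < N * (n / N + 1)`, one factor `q⁻¹` pays for the remainder of `n` modulo
  -- `N`.
  have hle : q ^ (n / N) ≤ q⁻¹ * θ ^ n := by
    rw [← div_eq_inv_mul, le_div_iff₀ hq0, ← pow_succ, ← hθN, ← pow_mul]
    refine pow_le_pow_of_le_one hθ0.le hθ1.le ?_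
    have := Nat.lt_mul_div_succ n hN
    omega
  have hL := h.nonneg
  intro x y
  have hg := gauge_nonneg m x y
  refine ⟨(h1 x y).1.trans ?_, (h1 x y).2.trans ?_⟩ <;> gcongr

/-! ### The invariant density and the shift -/

lemma density_pos_factors {m : ℕ} (hm : 2 ≤ m) {x : ℝ} (hx : x ∈ Icc (0 : ℝ) 1) :
    0 < 1 + ((m : ℝ) - 1) * x ∧ 0 < (m : ℝ) + ((m : ℝ) - 1) * x := by
  have hm' : (2 : ℝ) ≤ m := by exact_mod_cast hm
  have : 0 ≤ ((m : ℝ) - 1) * x := mul_nonneg (by linarith) hx.1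
  constructor <;> linarith

lemma log_normalizer_pos {m : ℕ} (hm : 2 ≤ m) :
    0 < Real.log ((m : ℝ) ^ 2 / (2 * (m : ℝ) - 1)) := by
  have hm' : (2 : ℝ) ≤ m := by exact_mod_cast hm
  apply Real.log_pos
  rw [lt_div_iff₀ (by linarith)]
  nlinarith

lemma c_pos {m : ℕ} (hm : 2 ≤ m) : 0 < c m := by
  have hm' : (2 : ℝ) ≤ m := by exact_mod_cast hm
  have ha : (0 : ℝ) < (m : ℝ) - 1 := by linarith
  exact div_pos (by positivity) (log_normalizer_pos hm)

lemma ρ_nonneg {m : ℕ} (hm : 2 ≤ m) {x : ℝ} (hx : x ∈ Icc (0 : ℝ) 1) : 0 ≤ ρ m x := by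
  obtain ⟨h1, h2⟩ := density_pos_factors hm hx
  unfold ρ; positivity

lemma measurable_ρ (m : ℕ) : Measurable (ρ m) := by unfold ρ; fun_prop

lemma measurable_density (m : ℕ) : Measurable fun x : I => ENNReal.ofReal (c m * ρ m (x : ℝ)) :=
  (((measurable_ρ m).comp measurable_subtype_coe).const_mul _).ennreal_ofReal

lemma integral_ρ {m : ℕ} (hm : 2 ≤ m) :
    IntervalIntegrable (ρ m) volume 0 1 ∧ ∫ x in (0 : ℝ)..1, ρ m x = (c m)⁻¹ := by
  have hm' : (2 : ℝ) ≤ m := by exact_mod_cast hm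
  have ha : (0 : ℝ) < (m : ℝ) - 1 := by linarith
  have hcont : ContinuousOn (ρ m) (uIcc 0 1) := by
    rw [uIcc_of_le zero_le_one]
    unfold ρ
    refine ContinuousOn.div continuousOn_const (by fun_prop) fun x hx => ?_
    obtain ⟨h1, h2⟩ := density_pos_factors hm hx
    positivity
  -- The antiderivative comes from splitting `ρ` into partial fractions.
  have hderiv : ∀ x ∈ uIcc (0 : ℝ) 1, HasDerivAt (fun x => (Real.log (1 + ((m : ℝ) - 1) * x) -
      Real.log ((m : ℝ) + ((m : ℝ) - 1) * x)) / ((m : ℝ) - 1) ^ 2) (ρ m x) x := fun x hx => by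
    rw [uIcc_of_le zero_le_one] at hx
    obtain ⟨h1, h2⟩ := density_pos_factors hm hx
    have d := (((((hasDerivAt_id x).const_mul ((m : ℝ) - 1)).const_add 1).log h1.ne').sub
      ((((hasDerivAt_id x).const_mul ((m : ℝ) - 1)).const_add (m : ℝ)).log h2.ne')).div_const
      (((m : ℝ) - 1) ^ 2)
    have e : ρ m x = (((m : ℝ) - 1) * 1 / (1 + ((m : ℝ) - 1) * id x) -
        ((m : ℝ) - 1) * 1 / ((m : ℝ) + ((m : ℝ) - 1) * id x)) / ((m : ℝ) - 1) ^ 2 := by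
      unfold ρ
      simp only [id, mul_one]
      field_simp
      ring
    rw [e]
    exact d
  refine ⟨hcont.intervalIntegrable, ?_⟩
  rw [intervalIntegral.integral_eq_sub_of_hasDerivAt hderiv hcont.intervalIntegrable]
  have hm0 : (m : ℝ) ≠ 0 := by linarith
  have h2m : (2 * (m : ℝ) - 1) ≠ 0 := by linarith
  rw [c, inv_div, Real.log_div (by positivity) h2m, Real.log_pow, ← sub_div]
  congr 1
  simp only [mul_one, mul_zero, add_zero, Real.log_one, zero_sub]
  rw [show (1 : ℝ) + (m - 1) = m by ring, show (m : ℝ) + (m - 1) = 2 * m - 1 by ring]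
  push_cast
  ring

lemma lintegral_unitInterval (F : ℝ → ℝ≥0∞) :
    ∫⁻ x : I, F x = ∫⁻ x in Icc (0 : ℝ) 1, F x :=
  lintegral_subtype_comap measurableSet_Icc F

lemma isProbabilityMeasure_γ {m : ℕ} (hm : 2 ≤ m) : IsProbabilityMeasure (γ m) := by
  constructor
  rw [γ, withDensity_apply _ MeasurableSet.univ, Measure.restrict_univ,
    lintegral_unitInterval (fun x => ENNReal.ofReal (c m * ρ m x))]
  have hint := (integral_ρ hm).1
  rw [intervalIntegrable_iff_integrableOn_Icc_of_le zero_le_one] at hint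
  rw [← ofReal_integral_eq_lintegral_ofReal (hint.const_mul _), integral_const_mul,
    integral_Icc_eq_integral_Ioc, ← intervalIntegral.integral_of_le zero_le_one,
    (integral_ρ hm).2, mul_inv_cancel₀ (c_pos hm).ne', ENNReal.ofReal_one]
  filter_upwards [ae_restrict_mem measurableSet_Icc] with x hx
  exact mul_nonneg (c_pos hm).le (ρ_nonneg hm hx)

/-- The inverse branches of the shift as real functions. -/
def branch (m i : ℕ) (x : ℝ) : ℝ := ((m : ℝ) ^ i)⁻¹ / (1 + ((m : ℝ) - 1) * x)

lemma branch_coe (m : ℕ) (hm : 2 ≤ m) (i : ℕ) (x : I) : branch m i x = u m hm i x := rfl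

lemma hasDerivAt_branch {m : ℕ} (hm : 2 ≤ m) (i : ℕ) {x : ℝ} (hx : x ∈ Icc (0 : ℝ) 1) :
    HasDerivAt (branch m i)
      (-(((m : ℝ) ^ i)⁻¹ * ((m : ℝ) - 1)) / (1 + ((m : ℝ) - 1) * x) ^ 2) x := by
  have h1 := (density_pos_factors hm hx).1
  have d := (hasDerivAt_const x ((m : ℝ) ^ i)⁻¹).div
    (((hasDerivAt_id x).const_mul ((m : ℝ) - 1)).const_add 1) h1.ne'
  simp only [id, zero_mul, mul_one, zero_sub] at d
  exact d

/-- The branches are decreasing, so dropping the right endpoint of the domain makes the images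
half-open intervals that tile `(0, 1]` without overlap. -/
lemma image_branch {m : ℕ} (hm : 2 ≤ m) (i : ℕ) :
    branch m i '' Ico 0 1 = Ioc ((m : ℝ)⁻¹ ^ (i + 1)) ((m : ℝ)⁻¹ ^ i) := by
  have hm' : (2 : ℝ) ≤ m := by exact_mod_cast hm
  have ha : (0 : ℝ) < (m : ℝ) - 1 := by linarith
  have hb : 0 < (m : ℝ)⁻¹ ^ i := by positivity
  have hm0 : (0 : ℝ) < m := by linarith
  ext y
  simp only [mem_image, mem_Ico, mem_Ioc, branch, ← inv_pow]
  rw [pow_succ]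
  generalize (m : ℝ)⁻¹ ^ i = b at *
  constructor
  · rintro ⟨x, ⟨hx0, hx1⟩, rfl⟩
    have h0 : 0 ≤ ((m : ℝ) - 1) * x := by positivity
    have h1 : ((m : ℝ) - 1) * x < m - 1 := mul_lt_of_lt_one_right ha hx1
    rw [← div_eq_mul_inv]
    exact ⟨div_lt_div_of_pos_left hb (by linarith) (by linarith),
      div_le_self hb.le (by linarith)⟩
  · rintro ⟨h1, h2⟩
    have hy : 0 < y := lt_trans (by positivity) h1
    rw [← div_eq_mul_inv, div_lt_iff₀ hm0] at h1
    refine ⟨(b / y - 1) / (m - 1), ⟨div_nonneg ?_ ha.le, ?_⟩, ?_⟩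
    · rw [sub_nonneg, one_le_div hy]; exact h2
    · rw [div_lt_one ha, sub_lt_sub_iff_right, div_lt_iff₀ hy]; linarith
    · field_simp
      ring

lemma injOn_branch {m : ℕ} (hm : 2 ≤ m) (i : ℕ) : InjOn (branch m i) (Ico 0 1) := by
  have hm' : (2 : ℝ) ≤ m := by exact_mod_cast hm
  intro x hx y hy hxy
  have h1 := (density_pos_factors hm (Ico_subset_Icc_self hx)).1
  have h2 := (density_pos_factors hm (Ico_subset_Icc_self hy)).1
  have hb : ((m : ℝ) ^ i)⁻¹ ≠ 0 := by positivity
  unfold branch at hxy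
  rw [div_eq_mul_inv, div_eq_mul_inv] at hxy
  have h := add_left_cancel (inv_injective (mul_left_cancel₀ hb hxy))
  exact mul_left_cancel₀ (by linarith : (m : ℝ) - 1 ≠ 0) h

lemma iUnion_image_branch {m : ℕ} (hm : 2 ≤ m) :
    ⋃ i, branch m i '' Ico 0 1 = Ioc (0 : ℝ) 1 := by
  have hm' : (2 : ℝ) ≤ m := by exact_mod_cast hm
  have h1 : (m : ℝ)⁻¹ < 1 := inv_lt_one_of_one_lt₀ (by linarith)
  have h0 : (0 : ℝ) < (m : ℝ)⁻¹ := by positivity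
  simp_rw [image_branch hm]
  ext y
  simp only [mem_iUnion, mem_Ioc]
  constructor
  · rintro ⟨i, hi, hi'⟩
    exact ⟨lt_trans (by positivity) hi, hi'.trans (pow_le_one₀ h0.le h1.le)⟩
  · rintro ⟨hy0, hy1⟩
    exact exists_nat_pow_near_of_lt_one hy0 hy1 h0 h1

lemma pairwise_disjoint_image_branch {m : ℕ} (hm : 2 ≤ m) :
    Pairwise (Function.onFun Disjoint fun i => branch m i '' Ico 0 1) := by
  have hm' : (2 : ℝ) ≤ m := by exact_mod_cast hm
  have h1 : (m : ℝ)⁻¹ < 1 := inv_lt_one_of_one_lt₀ (by linarith)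
  simp_rw [image_branch hm]
  exact (pow_right_anti₀ (by positivity) h1.le).pairwise_disjoint_on_Ioc_succ

/-- The density is a fixed point of the transfer operator of the shift, branch by branch. -/
lemma abs_deriv_branch_mul_density {m : ℕ} (hm : 2 ≤ m) (i : ℕ) {x : ℝ} (hx : x ∈ Icc (0 : ℝ) 1) :
    |-(((m : ℝ) ^ i)⁻¹ * ((m : ℝ) - 1)) / (1 + ((m : ℝ) - 1) * x) ^ 2| * (c m * ρ m (branch m i x)) =
      c m * ρ m x * P m i (((m : ℝ) - 1) * x) := by
  have hm' : (2 : ℝ) ≤ m := by exact_mod_cast hm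
  have ha : (0 : ℝ) < (m : ℝ) - 1 := by linarith
  have hm0 : (0 : ℝ) < m := by linarith
  obtain ⟨h1, h2⟩ := density_pos_factors hm hx
  have hs : 0 ≤ ((m : ℝ) - 1) * x := mul_nonneg ha.le hx.1
  have hb : 0 < ((m : ℝ) ^ (i + 1))⁻¹ := by positivity
  have hbi : ((m : ℝ) ^ i)⁻¹ = m * ((m : ℝ) ^ (i + 1))⁻¹ := by
    rw [pow_succ]; field_simp
  rw [abs_div, abs_neg, abs_of_pos (by positivity), abs_of_pos (by positivity)]
  unfold ρ branch P
  rw [hbi]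
  generalize ((m : ℝ) ^ (i + 1))⁻¹ = b at *
  generalize ((m : ℝ) - 1) * x = s at *
  have e1 : 1 + ((m : ℝ) - 1) * (m * b / (1 + s)) = (s + (m - 1) * (m * b) + 1) / (1 + s) := by
    field_simp; ring
  have e2 : (m : ℝ) + ((m : ℝ) - 1) * (m * b / (1 + s)) =
      m * (s + (m - 1) * b + 1) / (1 + s) := by
    field_simp; ring
  rw [e1, e2]
  have p1 : 0 < s + ((m : ℝ) - 1) * (m * b) + 1 := by positivity
  have p2 : 0 < s + ((m : ℝ) - 1) * b + 1 := by positivity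
  have p3 : 0 < s + (m : ℝ) := by linarith
  field_simp
  ring

lemma lintegral_Q {m : ℕ} (hm : 2 ≤ m) {F : I → ℝ≥0∞} (hF : Measurable F) (x : I) :
    ∫⁻ y, F y ∂(Q m hm x) = ∑' i, ENNReal.ofReal (P m i (scale m x)) * F (u m hm i x) := by
  rw [Q_eq_sum, lintegral_sum_measure]
  refine tsum_congr fun i => ?_
  rw [lintegral_smul_measure, lintegral_dirac' _ hF, smul_eq_mul]

lemma lintegral_γ (m : ℕ) {F : I → ℝ≥0∞} (hF : Measurable F) :
    ∫⁻ x, F x ∂(γ m) = ∫⁻ x : I, ENNReal.ofReal (c m * ρ m x) * F x := by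
  rw [γ, lintegral_withDensity_eq_lintegral_mul _ (measurable_density m) hF]
  rfl

/-- Substituting `y = u_i(x)` turns the `i`-th weighted term into the integral of `F` over the
`i`-th tile; the Jacobian identity is `abs_deriv_branch_mul_density`. -/
lemma lintegral_lintegral_Q_γ {m : ℕ} (hm : 2 ≤ m) {F : I → ℝ≥0∞} (hF : Measurable F) :
    ∫⁻ x, ∫⁻ y, F y ∂(Q m hm x) ∂(γ m) = ∫⁻ x, F x ∂(γ m) := by
  -- `F` is extended to the line by projection, so that the real change of variables applies.
  have hF' : Measurable fun x : ℝ => F (projIcc 0 1 zero_le_one x) :=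
    hF.comp continuous_projIcc.measurable
  have hbr : ∀ i, Measurable (branch m i) := fun i => by unfold branch; fun_prop
  have hQ : Measurable fun x => ∫⁻ y, F y ∂(Q m hm x) := hF.lintegral_kernel
  set G : ℝ → ℝ≥0∞ := fun x => ENNReal.ofReal (c m * ρ m x) * F (projIcc 0 1 zero_le_one x)
    with hG
  have hR : ∫⁻ x, F x ∂(γ m) = ∫⁻ x in Icc (0 : ℝ) 1, G x := by
    rw [lintegral_γ m hF, ← lintegral_unitInterval]
    refine lintegral_congr fun x => ?_
    simp only [hG, projIcc_val]
  have hL : ∫⁻ x, ∫⁻ y, F y ∂(Q m hm x) ∂(γ m) = ∫⁻ x in Icc (0 : ℝ) 1,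
      ∑' i, ENNReal.ofReal (c m * ρ m x) * (ENNReal.ofReal (P m i (((m : ℝ) - 1) * x)) *
        F (projIcc 0 1 zero_le_one (branch m i x))) := by
    rw [lintegral_γ m hQ, ← lintegral_unitInterval]
    refine lintegral_congr fun x => ?_
    rw [lintegral_Q hm hF, ENNReal.tsum_mul_left]
    simp only [branch_coe m hm, projIcc_val, scale]
  have hIcc : (volume.restrict (Icc (0 : ℝ) 1)) = volume.restrict (Ico (0 : ℝ) 1) :=
    Measure.restrict_congr_set Ico_ae_eq_Icc.symm
  have hpart : ∫⁻ x in Icc (0 : ℝ) 1, G x = ∑' i, ∫⁻ x in branch m i '' Ico 0 1, G x := by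
    rw [Measure.restrict_congr_set (Ioc_ae_eq_Icc (a := (0 : ℝ)) (b := 1)).symm,
      ← iUnion_image_branch hm,
      lintegral_iUnion (fun i => by rw [image_branch hm]; exact measurableSet_Ioc)
        (pairwise_disjoint_image_branch hm)]
  rw [hL, hR, hpart, hIcc, lintegral_tsum fun i => ?_]
  · refine tsum_congr fun i => ?_
    rw [lintegral_image_eq_lintegral_abs_deriv_mul measurableSet_Ico
      (fun x hx => (hasDerivAt_branch hm i (Ico_subset_Icc_self hx)).hasDerivWithinAt)
      (injOn_branch hm i)]
    refine setLIntegral_congr_fun measurableSet_Ico fun x hx => ?_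
    have hx' := Ico_subset_Icc_self hx
    simp only [hG]
    rw [← mul_assoc, ← mul_assoc, ← ENNReal.ofReal_mul (abs_nonneg _),
      abs_deriv_branch_mul_density hm i hx',
      ENNReal.ofReal_mul (mul_nonneg (c_pos hm).le (ρ_nonneg hm hx'))]
  · refine Measurable.aemeasurable ?_
    refine (((measurable_ρ m).const_mul _).ennreal_ofReal).mul
      (((measurable_P m i).comp (by fun_prop)).ennreal_ofReal.mul ?_)
    exact hF'.comp (hbr i)

lemma isStationary_γ {m : ℕ} (hm : 2 ≤ m) : IsStationary m hm (γ m) := fun A hA => by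
  have h := lintegral_lintegral_Q_γ hm (F := A.indicator 1) (measurable_one.indicator hA)
  simpa only [lintegral_indicator_one hA] using h

lemma measurable_T (m : ℕ) (hm : 2 ≤ m) : Measurable (T m hm) := by
  unfold T
  refine Measurable.subtype_mk (Measurable.ite ?_ measurable_const ?_)
  · exact measurable_subtype_coe (measurableSet_singleton (0 : ℝ))
  · refine Measurable.div_const (Measurable.sub_const ?_ _) _
    refine Measurable.pow measurable_const ?_
    have : Measurable fun x : I => Real.log (x : ℝ)⁻¹ / Real.log m := by fun_prop
    exact this.sub (measurable_from_top.comp (Int.measurable_floor.comp this))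

/-- The base-`m` logarithm of `1/u_i(x)` is `i + log_m(1+(m-1)x)`, whose last term is in `[0, 1)`.
At `x = 1` it equals 1, and `T` returns 0 instead. -/
lemma T_u {m : ℕ} (hm : 2 ≤ m) (i : ℕ) {x : I} (hx : (x : ℝ) < 1) : T m hm (u m hm i x) = x := by
  have hm' : (2 : ℝ) ≤ m := by exact_mod_cast hm
  have ha : (0 : ℝ) < (m : ℝ) - 1 := by linarith
  have hm0 : (0 : ℝ) < m := by linarith
  have hlog : 0 < Real.log m := Real.log_pos (by linarith)
  have hs0 : 0 ≤ ((m : ℝ) - 1) * (x : ℝ) := scale_nonneg hm x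
  have hs1 : ((m : ℝ) - 1) * (x : ℝ) < m - 1 := mul_lt_of_lt_one_right ha hx
  apply Subtype.ext
  have hu : (u m hm i x : ℝ) = ((m : ℝ) ^ i)⁻¹ / (1 + ((m : ℝ) - 1) * (x : ℝ)) := rfl
  have hu0 : (u m hm i x : ℝ) ≠ 0 := by rw [hu]; positivity
  have ht : Real.log (u m hm i x : ℝ)⁻¹ / Real.log m =
      (i : ℝ) + Real.log (1 + ((m : ℝ) - 1) * (x : ℝ)) / Real.log m := by
    rw [hu, inv_div, div_inv_eq_mul, Real.log_mul (by positivity) (by positivity), Real.log_pow]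
    field_simp
    ring
  have hfr : Int.fract ((i : ℝ) + Real.log (1 + ((m : ℝ) - 1) * (x : ℝ)) / Real.log m) =
      Real.log (1 + ((m : ℝ) - 1) * (x : ℝ)) / Real.log m := by
    rw [Int.fract_natCast_add, Int.fract_eq_self]
    refine ⟨div_nonneg (Real.log_nonneg (by linarith)) hlog.le, ?_⟩
    rw [div_lt_one hlog]
    exact Real.log_lt_log (by linarith) (by linarith)
  simp only [T, if_neg hu0]
  rw [ht, Int.self_sub_floor, hfr, Real.rpow_def_of_pos hm0, mul_div_cancel₀ _ hlog.ne',
    Real.exp_log (by linarith)]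
  field_simp
  ring

/-- By stationarity, `γ(T⁻¹A)` is the integral of `Q(x, T⁻¹A)`. From `x < 1` the chain always jumps
to a `T`-preimage of `x`, so the integrand is the indicator of `A` almost everywhere. -/
lemma measurePreserving_T {m : ℕ} (hm : 2 ≤ m) : MeasurePreserving (T m hm) (γ m) (γ m) := by
  refine ⟨measurable_T m hm, ?_⟩
  ext A hA
  have hTA := measurable_T m hm hA
  rw [Measure.map_apply (measurable_T m hm) hA, ← isStationary_γ hm _ hTA]
  have hne : ∀ᵐ x : I ∂(γ m), (x : ℝ) < 1 := by
    refine (withDensity_absolutelyContinuous _ _).ae_le ?_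
    have h1 : ∀ᵐ x : I, x ≠ 1 := by
      rw [ae_iff]; simp
    filter_upwards [h1] with x hx
    exact lt_of_le_of_ne x.2.2 fun h => hx (Subtype.ext h)
  calc ∫⁻ x, Q m hm x (T m hm ⁻¹' A) ∂(γ m) = ∫⁻ x, A.indicator 1 x ∂(γ m) := by
        refine lintegral_congr_ae ?_
        filter_upwards [hne] with x hx
        rw [← lintegral_indicator_one hTA, lintegral_Q hm (measurable_one.indicator hTA)]
        have e : ∀ i, (T m hm ⁻¹' A).indicator (1 : I → ℝ≥0∞) (u m hm i x) = A.indicator 1 x :=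
          fun i => by
            have hmem : u m hm i x ∈ T m hm ⁻¹' A ↔ x ∈ A := by rw [mem_preimage, T_u hm i hx]
            by_cases h : x ∈ A
            · rw [indicator_of_mem h, indicator_of_mem (hmem.2 h)]; rfl
            · rw [indicator_of_notMem h, indicator_of_notMem (mt hmem.1 h)]
        simp_rw [e]
        have hs := scale_nonneg hm x
        rw [ENNReal.tsum_mul_right, ← ENNReal.ofReal_tsum_of_nonneg (fun i => P_nonneg hm i hs)
          (hasSum_P hm hs).summable, (hasSum_P hm hs).tsum_eq, ENNReal.ofReal_one, one_mul]
    _ = γ m A := lintegral_indicator_one hA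

/-! ### Convergence and uniqueness -/

lemma integral_step_eq {m : ℕ} {hm : 2 ≤ m} {μ : Measure I} [IsProbabilityMeasure μ]
    (h : IsStationary m hm μ) {f : I → ℝ} (hf : Continuous f) :
    ∫ x, step m hm f x ∂μ = ∫ x, f x ∂μ := by
  have e : (Q m hm ∘ₖ Kernel.const Unit μ) () = μ := by
    ext A hA
    rw [Kernel.comp_apply' _ _ _ hA, Kernel.const_apply, h A hA]
  have h1 := Kernel.integral_comp (η := Q m hm) (κ := Kernel.const Unit μ) (a := ()) (f := f)
    (integrable_of_continuous hf)
  rw [e, Kernel.const_apply] at h1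
  exact h1.symm

/-- `Qn` appends the new step at the end of the path, so that step is the first to act on `f`. -/
lemma Un_succ (m : ℕ) (hm : 2 ≤ m) (n : ℕ) {f : I → ℝ} (hf : Continuous f) (x : I) :
    Un m hm (n + 1) f x = Un m hm n (step m hm f) x :=
  Kernel.integral_comp (η := Q m hm) (κ := Qn m hm n) (a := x) (f := f)
    (integrable_of_continuous hf)

lemma Un_eq_iterate {m : ℕ} {hm : 2 ≤ m} {f : I → ℝ}
    (hc : ∀ n, Continuous ((step m hm)^[n] f)) (n : ℕ) (x : I) :
    Un m hm n f x = (step m hm)^[n] f x := by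
  induction n generalizing f with
  | zero => simp [Un, Qn, Kernel.id_apply]
  | succ n ih => rw [Un_succ m hm n (show Continuous f from hc 0), ih fun k => hc (k + 1), Function.iterate_succ_apply]

lemma abs_sub_integral_le {μ : Measure I} [IsProbabilityMeasure μ] {f : I → ℝ} (hf : Continuous f)
    {a B : ℝ} (h : ∀ x, |a - f x| ≤ B) : |a - ∫ x, f x ∂μ| ≤ B := by
  have e : a - ∫ x, f x ∂μ = ∫ x, (a - f x) ∂μ := by
    rw [integral_sub (integrable_const a) (integrable_of_continuous hf)]
    simp
  have h' : ∀ x, ‖a - f x‖ ≤ B := h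
  rw [e, ← Real.norm_eq_abs]
  simpa using norm_integral_le_of_norm_le_const (μ := μ) (.of_forall h')

lemma abs_integral_sub_integral_le {μ : Measure I} [IsProbabilityMeasure μ] {f g : I → ℝ}
    (hf : Continuous f) (hg : Continuous g) {B : ℝ} (h : ∀ x, |f x - g x| ≤ B) :
    |∫ x, f x ∂μ - ∫ x, g x ∂μ| ≤ B := by
  have h' : ∀ x, ‖f x - g x‖ ≤ B := h
  rw [← integral_sub (integrable_of_continuous hf) (integrable_of_continuous hg),
    ← Real.norm_eq_abs]
  simpa using norm_integral_le_of_norm_le_const (μ := μ) (.of_forall h')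

/-- The interval has diameter 1, and `|x - y|` is at most `gauge / ((m-1)/m)`, hence at most
`gauge/δ`. -/
lemma oscBound_of_abs_sub_le {m : ℕ} (hm : 2 ≤ m) {δ K : ℝ} (hδ : 0 < δ)
    (hδm : δ ≤ ((m : ℝ) - 1) / m) (hK : 0 ≤ K) {f : I → ℝ}
    (h : ∀ x y : I, |f x - f y| ≤ K * |(x : ℝ) - y|) : OscBound m δ K f := fun x y => by
  have hm' : (2 : ℝ) ≤ m := by exact_mod_cast hm
  have ha : (0 : ℝ) < (m : ℝ) - 1 := by linarith
  have hg := gauge_nonneg m x y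
  refine ⟨(h x y).trans (mul_le_of_le_one_right hK ?_), (h x y).trans ?_⟩
  · exact abs_le.2 ⟨by linarith [x.2.1, y.2.2], by linarith [x.2.2, y.2.1]⟩
  · refine mul_le_mul_of_nonneg_left ?_ hK
    have h1 := abs_le_gauge hm x y
    rw [abs_scale_sub hm] at h1
    have h2 : |(x : ℝ) - y| ≤ gauge m x y / (((m : ℝ) - 1) / m) := by
      rw [div_div_eq_mul_div, le_div_iff₀ ha]
      linarith
    exact h2.trans (by gcongr)

/-- Geometric convergence of `Un m hm n f` in the Lipschitz sense, for every stationary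
probability measure. -/
lemma exists_rate {m : ℕ} (hm : 2 ≤ m) :
    ∃ q k D : ℝ, 0 < q ∧ q < 1 ∧ 0 < k ∧ 0 < D ∧ ∀ (μ : Measure I) (n : ℕ) (f : I → ℝ) (K : ℝ),
      IsProbabilityMeasure μ → IsStationary m hm μ → 0 ≤ K →
      (∀ x y : I, |f x - f y| ≤ K * |(x : ℝ) - y|) →
      (∀ x, |Un m hm n f x - ∫ y, f y ∂μ| ≤ k * q ^ n * K) ∧
      ∀ x y, |Un m hm n f x - Un m hm n f y| ≤ D * q ^ n * K * |(x : ℝ) - y| := by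
  have hm' : (2 : ℝ) ≤ m := by exact_mod_cast hm
  have ha : (0 : ℝ) < (m : ℝ) - 1 := by linarith
  obtain ⟨δ, q, C, hδ, hδr, hq0, hq1, hC, hit⟩ := exists_geometric_bound hm
  refine ⟨q, C, C * ((m : ℝ) - 1) / δ, hq0, hq1, hC, by positivity,
    fun μ n f K hμ hst hK hf => ?_⟩
  have hosc := fun n => hit n K f (oscBound_of_abs_sub_le hm hδ hδr hK hf)
  have hc := fun n => (hosc n).continuous hm hδ
  have hinv : ∀ n, ∫ x, (step m hm)^[n] f x ∂μ = ∫ x, f x ∂μ := fun n => by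
    induction n with
    | zero => rfl
    | succ n ih => simp_rw [Function.iterate_succ_apply']; rw [integral_step_eq hst (hc n), ih]
  refine ⟨fun x => ?_, fun x y => ?_⟩
  -- By stationarity the limit is the mean of the `n`-th iterate itself, so its distance to any
  -- value is at most the oscillation.
  · rw [Un_eq_iterate hc, ← hinv n]
    exact abs_sub_integral_le (hc n) fun y => (hosc n x y).1
  · rw [Un_eq_iterate hc, Un_eq_iterate hc]
    refine ((hosc n).abs_sub_le hm hδ x y).trans (le_of_eq ?_)
    ring

/-- By Weierstrass, a polynomial will do: it is Lipschitz on the compact interval. -/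
lemma exists_lipschitz_near {f : I → ℝ} (hf : Continuous f) {ε : ℝ} (hε : 0 < ε) :
    ∃ g : I → ℝ, Continuous g ∧ (∃ K : ℝ, 0 ≤ K ∧ ∀ x y : I, |g x - g y| ≤ K * |(x : ℝ) - y|) ∧
      ∀ x, |f x - g x| ≤ ε := by
  obtain ⟨p, hp⟩ := exists_polynomial_near_continuousMap 0 1 ⟨f, hf⟩ ε hε
  obtain ⟨K, hK⟩ := (show ContDiff ℝ 1 fun x => p.eval x by
    simpa only [Polynomial.coe_aeval_eq_eval] using p.contDiff_aeval (𝕜 := ℝ) 1).contDiffOn.exists_lipschitzOnWith one_ne_zero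
    (convex_Icc (0 : ℝ) 1) isCompact_Icc
  refine ⟨fun x => p.eval (x : ℝ), by fun_prop, ⟨K, K.2, fun x y => ?_⟩, fun x => ?_⟩
  · simpa only [Real.dist_eq] using hK.dist_le_mul x x.2 y y.2
  · have h := (ContinuousMap.norm_coe_le_norm _ x).trans hp.le
    rw [abs_sub_comm]
    exact h

/-- Averaging does not increase uniform distance, so the Lipschitz rate extends to continuous
functions by approximation. -/
lemma isLimit_γ {m : ℕ} (hm : 2 ≤ m) : IsLimit m hm (γ m) := fun f hf => by
  have := isProbabilityMeasure_γ hm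
  obtain ⟨q, k, D, hq0, hq1, hk, -, hrate⟩ := exists_rate hm
  rw [Metric.tendstoUniformly_iff]
  intro ε hε
  obtain ⟨g, hg, ⟨K, hK0, hK⟩, hfg⟩ := exists_lipschitz_near hf (show 0 < ε / 4 by positivity)
  have hlim : Tendsto (fun n : ℕ => k * q ^ n * K) atTop (𝓝 (k * 0 * K)) :=
    ((tendsto_pow_atTop_nhds_zero_of_lt_one hq0.le hq1).const_mul k).mul_const K
  rw [mul_zero, zero_mul] at hlim
  filter_upwards [hlim.eventually_lt_const (show 0 < ε / 4 by positivity)] with n hn x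
  have h1 := (hrate (γ m) n g K this (isStationary_γ hm) hK0 hK).1 x
  have h2 : |Un m hm n f x - Un m hm n g x| ≤ ε / 4 := abs_integral_sub_integral_le hf hg hfg
  have h3 : |∫ y, f y ∂(γ m) - ∫ y, g y ∂(γ m)| ≤ ε / 4 := abs_integral_sub_integral_le hf hg hfg
  rw [Real.dist_eq, abs_lt]
  rw [abs_le] at h1 h2 h3
  constructor <;> linarith

lemma eq_of_forall_integral_eq {μ ν : Measure I} [IsProbabilityMeasure μ] [IsProbabilityMeasure ν]
    (h : ∀ f : I → ℝ, Continuous f → ∫ x, f x ∂μ = ∫ x, f x ∂ν) : μ = ν :=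
  ext_of_forall_integral_eq_of_IsFiniteMeasure fun f => h f f.continuous

/-- For Lipschitz `g`, `Un g` at 0 converges to the integral of `g` against any stationary
probability measure, so all these integrals agree. -/
lemma IsStationary.eq_γ {m : ℕ} {hm : 2 ≤ m} {μ : Measure I} [IsProbabilityMeasure μ]
    (h : IsStationary m hm μ) : μ = γ m := by
  have hγ := isProbabilityMeasure_γ hm
  obtain ⟨q, k, D, hq0, hq1, hk, -, hrate⟩ := exists_rate hm
  refine eq_of_forall_integral_eq fun f hf => eq_of_forall_dist_le fun ε hε => ?_
  obtain ⟨g, hg, ⟨K, hK0, hK⟩, hfg⟩ := exists_lipschitz_near hf (show 0 < ε / 2 by positivity)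
  have hlim : Tendsto (fun n : ℕ => k * q ^ n * K) atTop (𝓝 (k * 0 * K)) :=
    ((tendsto_pow_atTop_nhds_zero_of_lt_one hq0.le hq1).const_mul k).mul_const K
  rw [mul_zero, zero_mul] at hlim
  have hgμ : Tendsto (fun n => Un m hm n g 0) atTop (𝓝 (∫ x, g x ∂μ)) := tendsto_iff_dist_tendsto_zero.2 (squeeze_zero (fun _ => dist_nonneg)
    (fun n => (hrate μ n g K inferInstance h hK0 hK).1 0) hlim)
  have hgγ : Tendsto (fun n => Un m hm n g 0) atTop (𝓝 (∫ x, g x ∂(γ m))) := tendsto_iff_dist_tendsto_zero.2 (squeeze_zero (fun _ => dist_nonneg)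
    (fun n => (hrate (γ m) n g K hγ (isStationary_γ hm) hK0 hK).1 0) hlim)
  have e := tendsto_nhds_unique hgμ hgγ
  have h1 := abs_integral_sub_integral_le (μ := μ) hf hg hfg
  have h2 := abs_integral_sub_integral_le (μ := γ m) hf hg hfg
  rw [abs_le] at h1 h2
  rw [Real.dist_eq, abs_le]
  constructor <;> linarith

lemma IsLimit.eq_γ {m : ℕ} {hm : 2 ≤ m} {μ : Measure I} [IsProbabilityMeasure μ]
    (h : IsLimit m hm μ) : μ = γ m := by
  have hγ := isProbabilityMeasure_γ hm
  exact eq_of_forall_integral_eq fun f hf =>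
    tendsto_nhds_unique ((h f hf).tendsto_at 0) ((isLimit_γ hm f hf).tendsto_at 0)

/-! ### The Lipschitz norm -/

lemma normL_ne_top {f : I → ℝ} {K : ℝ≥0} (hf : LipschitzWith K f) : normL f ≠ ∞ := by
  obtain ⟨M, hM⟩ := isCompact_univ.exists_bound_of_continuousOn hf.continuous.continuousOn
  refine ENNReal.add_ne_top.2 ⟨?_, ?_⟩
  · refine ne_top_of_le_ne_top (ENNReal.ofReal_ne_top (r := M)) (iSup_le fun x => ?_)
    exact ENNReal.ofReal_le_ofReal (hM x (mem_univ x))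
  · refine ne_top_of_le_ne_top (ENNReal.ofReal_ne_top (r := K))
      (iSup_le fun x => iSup_le fun y => iSup_le fun _ => ENNReal.ofReal_le_ofReal ?_)
    refine div_le_of_le_mul₀ (abs_nonneg _) K.2 ?_
    have := hf.dist_le_mul x y
    rwa [Real.dist_eq, Subtype.dist_eq, Real.dist_eq] at this

lemma abs_sub_le_normL {f : I → ℝ} (hf : normL f ≠ ∞) (x y : I) :
    |f x - f y| ≤ (normL f).toReal * |(x : ℝ) - y| := by
  rcases eq_or_ne x y with rfl | hxy
  · simp
  have hd : 0 < |(x : ℝ) - y| := abs_pos.2 (sub_ne_zero.2 fun h => hxy (Subtype.ext h))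
  rw [← div_le_iff₀ hd, ← ENNReal.ofReal_le_iff_le_toReal hf]
  refine le_trans ?_ le_add_self
  exact le_iSup_of_le x (le_iSup_of_le y (le_iSup_of_le hxy le_rfl))

lemma normL_le {f : I → ℝ} {A B : ℝ} (hA : 0 ≤ A) (hB : 0 ≤ B) (h1 : ∀ x, |f x| ≤ A)
    (h2 : ∀ x y : I, |f x - f y| ≤ B * |(x : ℝ) - y|) : normL f ≤ ENNReal.ofReal (A + B) := by
  rw [ENNReal.ofReal_add hA hB]
  refine add_le_add (iSup_le fun x => ENNReal.ofReal_le_ofReal (h1 x))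
    (iSup_le fun x => iSup_le fun y => iSup_le fun _ => ENNReal.ofReal_le_ofReal ?_)
  exact div_le_of_le_mul₀ (abs_nonneg _) hB (h2 x y)

end ChanCF

end

theorem proposition4p3 (m : ℕ) (hm : 2 ≤ m) :
    -- `γ m`, the measure with density `c_m ρ_m`, is a probability measure invariant under `T_m`
    IsProbabilityMeasure (ChanCF.γ m) ∧
    MeasurePreserving (ChanCF.T m hm) (ChanCF.γ m) (ChanCF.γ m) ∧
    -- it is the only stationary probability measure of the chain
    (∀ μ : Measure unitInterval, IsProbabilityMeasure μ →
      (ChanCF.IsStationary m hm μ ↔ μ = ChanCF.γ m)) ∧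
    -- it is the limit of the `n`-step transition probabilities
    (∀ μ : Measure unitInterval, IsProbabilityMeasure μ →
      (ChanCF.IsLimit m hm μ ↔ μ = ChanCF.γ m)) ∧
    -- with geometric rate in the Lipschitz norm
    ∃ q k : ℝ, 0 < q ∧ q < 1 ∧ 0 < k ∧
      ∀ (n : ℕ) (f : unitInterval → ℝ), 1 ≤ n → (∃ K : ℝ≥0, LipschitzWith K f) →
        ChanCF.normL (fun x => ChanCF.Un m hm n f x - ∫ y, f y ∂(ChanCF.γ m)) ≤
          ENNReal.ofReal (k * q ^ n) * ChanCF.normL f := by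
  have hγ := ChanCF.isProbabilityMeasure_γ hm
  refine ⟨hγ, ChanCF.measurePreserving_T hm, fun μ _ => ⟨fun h => h.eq_γ, ?_⟩,
    fun μ _ => ⟨fun h => h.eq_γ, ?_⟩, ?_⟩
  · rintro rfl; exact ChanCF.isStationary_γ hm
  · rintro rfl; exact ChanCF.isLimit_γ hm
  obtain ⟨q, k, D, hq0, hq1, hk, hD, hrate⟩ := ChanCF.exists_rate hm
  -- `k` controls the supremum and `D` the Lipschitz seminorm; the norm of `f` serves as its
  -- Lipschitz constant.
  refine ⟨q, k + D, hq0, hq1, by positivity, fun n f _ ⟨K, hf⟩ => ?_⟩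
  have hfin := ChanCF.normL_ne_top hf
  have hN : 0 ≤ (ChanCF.normL f).toReal := ENNReal.toReal_nonneg
  obtain ⟨h1, h2⟩ := hrate (ChanCF.γ m) n f _ hγ (ChanCF.isStationary_γ hm) hN
    (ChanCF.abs_sub_le_normL hfin)
  rw [← ENNReal.ofReal_toReal hfin]
  rw [← ENNReal.ofReal_mul (by positivity)]
  refine (ChanCF.normL_le (A := k * q ^ n * (ChanCF.normL f).toReal)
    (B := D * q ^ n * (ChanCF.normL f).toReal) (by positivity) (by positivity) h1
    fun x y => ?_).trans_eq ?_
  · rw [sub_sub_sub_cancel_right]; exact h2 x y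
  · congr 1; ring
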